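/- Let $N$ be a natural number. A convex body in $\mathbb R^N$ is a closed convex set $\mathcal C\subset\mathbb R^N$ (possibly unbounded) with nonempty interior and $\mathcal C\neq\mathbb R^N$. For a Borel set $E$ and an open set $\Omega\subset\mathbb R^N$ let $$P(E;\Omega)=\sup\Big\{\int_E \operatorname{div}T\,dx:\ T\in C^1_c(\Omega;\mathbb R^N),\ |T|\le 1\Big\}\in[0,\infty]$$ be the distributional perimeter of $E$ in $\Omega$, and for a closed set $\mathcal C$ let $$I_{\mathcal C}(v)=\inf\big\{P(E;\mathbb R^N\setminus\mathcal C):\ E\subset\mathbb R^N\setminus\mathcal C\ \text{Borel},\ |E|=v\big\},\qquad v>0,$$ be its exterior isoperimetric profile, where $|E|$ is the Lebesgue measure of $E$. A sequence of nonempty closed sets $F_n\subset\mathbb R^N$ converges to a closed set $F$ in the Kuratowski sense if (i) whenever $x_n\in F_n$ for every $n$, every limit point of the sequence $(x_n)$ (that is, every limit of a subsequence) belongs to $F$, and (ii) every $x\in F$ is the limit of a sequence $(x_n)$ with $x_n\in F_n$ for every $n$. Let $(\mathcal C_n)_{n\in\mathbb N}$ be a sequence of convex bodies in $\mathbb R^N$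 converging in the Kuratowski sense to a convex body $\mathcal C$. Then, for every $v>0$, $$\limsup_{n\to\infty} I_{\mathcal C_n}(v)\le I_{\mathcal C}(v).$$ -/

import Mathlib

open MeasureTheory Filter Topology
open scoped ENNReal

namespace ExteriorIsoperimetric

/-- A convex body: a closed convex set with nonempty interior, different from the whole space
(it may be unbounded). -/
def IsConvexBody {N : ℕ} (C : Set (EuclideanSpace ℝ (Fin N))) : Prop :=
  IsClosed C ∧ Convex ℝ C ∧ (interior C).Nonempty ∧ C ≠ Set.univ

/-- Convergence in the Kuratowski sense of the sets `F n` to the set `G`: every limit point of a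
sequence `x n ∈ F n` lies in `G`, and every point of `G` is the limit of such a sequence. -/
def KuratowskiTendsto {N : ℕ} (F : ℕ → Set (EuclideanSpace ℝ (Fin N)))
    (G : Set (EuclideanSpace ℝ (Fin N))) : Prop :=
  (∀ x : ℕ → EuclideanSpace ℝ (Fin N), (∀ n, x n ∈ F n) →
      ∀ y, MapClusterPt y atTop x → y ∈ G) ∧
  (∀ y ∈ G, ∃ x : ℕ → EuclideanSpace ℝ (Fin N), (∀ n, x n ∈ F n) ∧ Tendsto x atTop (𝓝 y))

/-- The divergence of a vector field on `ℝ^N`. -/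
noncomputable def divergence {N : ℕ}
    (T : EuclideanSpace ℝ (Fin N) → EuclideanSpace ℝ (Fin N))
    (x : EuclideanSpace ℝ (Fin N)) : ℝ :=
  ∑ i : Fin N, (fderiv ℝ T x (EuclideanSpace.single i 1)) i

/-- The distributional perimeter `P(E; Ω)` of a Borel set `E` in an open set `Ω`, i.e. the supremum
of `∫_E div T` over all `T ∈ C¹_c(Ω; ℝ^N)` with `|T| ≤ 1`. -/
noncomputable def perimeterIn {N : ℕ} (E Ω : Set (EuclideanSpace ℝ (Fin N))) : ℝ≥0∞ :=
  ⨆ (T : EuclideanSpace ℝ (Fin N) → EuclideanSpace ℝ (Fin N)) (_ : ContDiff ℝ 1 T)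
    (_ : HasCompactSupport T) (_ : tsupport T ⊆ Ω) (_ : ∀ x, ‖T x‖ ≤ 1),
    ENNReal.ofReal (∫ x in E, divergence T x)

/-- The exterior isoperimetric profile of the closed set `C` at volume `v`: the infimum of
`P(E; ℝ^N \ C)` over Borel sets `E ⊆ ℝ^N \ C` with `|E| = v`. -/
noncomputable def exteriorProfile {N : ℕ} (C : Set (EuclideanSpace ℝ (Fin N))) (v : ℝ) : ℝ≥0∞ :=
  ⨅ (E : Set (EuclideanSpace ℝ (Fin N))) (_ : MeasurableSet E) (_ : E ⊆ Cᶜ)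
    (_ : volume E = ENNReal.ofReal v), perimeterIn E Cᶜ

end ExteriorIsoperimetric

namespace ExteriorIsoperimetric

/-! Suppose first that `N ≥ 2`, and let `E` be a competitor for `C`. Truncate `E` by a large ball
centred at an interior point `c` of `C`, at small cost in perimeter (`exists_truncation`), and
contract the result `G` towards `c` with ratio `t < 1`. The perimeter relative to the complement
does not increase when set and obstacle are contracted together (`perimeterIn_dilation_image_le`).
The gain is that the contracted obstacle lies in the interior of `C`, so its bounded part is
eventually contained in `Cs n` (`KuratowskiTendsto.eventually_subset`; convexity of the `Cs n` is
used here). Removing `Cs n` from the contracted `G` therefore gives a set `F` whose perimeter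
outside `Cs n` is at most that of `G` outside `C`. Its volume is at most `v`, and by Fatou's lemma
at least `v - δ`. The missing volume is restored by a ball disjoint from `F` and `Cs n`
(`exists_far_ball`), whose perimeter is small because `N ≥ 2` (`exists_small_ball`).

In dimension one small balls do not have small perimeter, but there the profile is identically `1`:
an interval touching the body has one free endpoint, and any set of positive finite volume has
perimeter at least `1`. In dimension zero there are no convex bodies.

No structure theory of finite perimeter sets is needed: slicing by balls is done with smooth cutoffs
and the growth rate of the volume in concentric balls. -/

variable {N : ℕ}

/-! ### Test fields and formal properties of the perimeter -/

/-- The vector fields tested in the definition of the perimeter in `Ω`. -/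
structure IsTestField (Ω : Set (EuclideanSpace ℝ (Fin N)))
    (T : EuclideanSpace ℝ (Fin N) → EuclideanSpace ℝ (Fin N)) : Prop where
  contDiff : ContDiff ℝ 1 T
  hasCompactSupport : HasCompactSupport T
  tsupport_subset : tsupport T ⊆ Ω
  norm_le : ∀ x, ‖T x‖ ≤ 1

theorem IsTestField.ofReal_integral_le {Ω : Set (EuclideanSpace ℝ (Fin N))}
    {T : EuclideanSpace ℝ (Fin N) → EuclideanSpace ℝ (Fin N)} (hT : IsTestField Ω T)
    (E : Set (EuclideanSpace ℝ (Fin N))) :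
    ENNReal.ofReal (∫ x in E, divergence T x) ≤ perimeterIn E Ω := by
  unfold perimeterIn
  exact le_iSup_of_le T <| le_iSup_of_le hT.contDiff <| le_iSup_of_le hT.hasCompactSupport <|
    le_iSup_of_le hT.tsupport_subset <| le_iSup_of_le hT.norm_le le_rfl

theorem perimeterIn_le {E Ω : Set (EuclideanSpace ℝ (Fin N))} {b : ℝ≥0∞}
    (h : ∀ T, IsTestField Ω T → ENNReal.ofReal (∫ x in E, divergence T x) ≤ b) :
    perimeterIn E Ω ≤ b := by
  unfold perimeterIn
  exact iSup_le fun T => iSup_le fun h1 => iSup_le fun h2 => iSup_le fun h3 => iSup_le fun h4 =>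
    h T ⟨h1, h2, h3, h4⟩

theorem exteriorProfile_le {C E : Set (EuclideanSpace ℝ (Fin N))} {v : ℝ} (hE : MeasurableSet E)
    (hEC : E ⊆ Cᶜ) (hv : volume E = ENNReal.ofReal v) :
    exteriorProfile C v ≤ perimeterIn E Cᶜ :=
  iInf_le_of_le E <| iInf_le_of_le hE <| iInf_le_of_le hEC <| iInf_le_of_le hv le_rfl

theorem IsTestField.mono {Ω Ω' : Set (EuclideanSpace ℝ (Fin N))}
    {T : EuclideanSpace ℝ (Fin N) → EuclideanSpace ℝ (Fin N)} (hT : IsTestField Ω T)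
    (h : Ω ⊆ Ω') : IsTestField Ω' T :=
  ⟨hT.contDiff, hT.hasCompactSupport, hT.tsupport_subset.trans h, hT.norm_le⟩

theorem perimeterIn_mono {E Ω Ω' : Set (EuclideanSpace ℝ (Fin N))} (h : Ω ⊆ Ω') :
    perimeterIn E Ω ≤ perimeterIn E Ω' :=
  perimeterIn_le fun _ hT => (hT.mono h).ofReal_integral_le E

theorem continuous_divergence {T : EuclideanSpace ℝ (Fin N) → EuclideanSpace ℝ (Fin N)}
    (hT : ContDiff ℝ 1 T) : Continuous (divergence T) := by
  have h := hT.continuous_fderiv one_ne_zero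
  unfold divergence
  fun_prop

theorem divergence_eq_zero {T : EuclideanSpace ℝ (Fin N) → EuclideanSpace ℝ (Fin N)}
    {x : EuclideanSpace ℝ (Fin N)} (hx : x ∉ tsupport T) : divergence T x = 0 := by
  simp [divergence, fderiv_of_notMem_tsupport ℝ hx]

theorem IsTestField.integrable {Ω : Set (EuclideanSpace ℝ (Fin N))}
    {T : EuclideanSpace ℝ (Fin N) → EuclideanSpace ℝ (Fin N)} (hT : IsTestField Ω T) :
    Integrable (divergence T) :=
  (continuous_divergence hT.contDiff).integrable_of_hasCompactSupport <|
    hT.hasCompactSupport.mono' fun x hx => by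
      by_contra h
      exact hx (divergence_eq_zero h)

/-- The integral of the divergence is additive over disjoint sets, and the supremum of a sum is at
most the sum of the suprema. -/
theorem perimeterIn_union_le {A B Ω : Set (EuclideanSpace ℝ (Fin N))} (h : Disjoint A B)
    (hB : MeasurableSet B) : perimeterIn (A ∪ B) Ω ≤ perimeterIn A Ω + perimeterIn B Ω := by
  refine perimeterIn_le fun T hT => ?_
  rw [setIntegral_union h hB hT.integrable.integrableOn hT.integrable.integrableOn]
  exact ENNReal.ofReal_add_le.trans
    (add_le_add (hT.ofReal_integral_le A) (hT.ofReal_integral_le B))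

/-- Removing a set that no test field sees does not change the perimeter. -/
theorem perimeterIn_diff_le {E C Ω : Set (EuclideanSpace ℝ (Fin N))} (hE : MeasurableSet E)
    (h : Disjoint C Ω) : perimeterIn (E \ C) Ω ≤ perimeterIn E Ω := by
  refine perimeterIn_le fun T hT => ?_
  rw [setIntegral_eq_of_subset_of_forall_sdiff_eq_zero hE Set.sdiff_subset
    (f := divergence T) ?_ |>.symm]
  · exact hT.ofReal_integral_le E
  · intro x hx
    refine divergence_eq_zero fun hxT => ?_
    have hxC : x ∈ C := by
      by_contra hxC
      exact hx.2 ⟨hx.1, hxC⟩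
    exact Set.disjoint_left.1 h hxC (hT.tsupport_subset hxT)

theorem integral_fderiv_eq_zero {f : EuclideanSpace ℝ (Fin N) → ℝ} (hf : ContDiff ℝ 1 f)
    (hc : HasCompactSupport f) (v : EuclideanSpace ℝ (Fin N)) : ∫ x, fderiv ℝ f x v = 0 := by
  -- Integration by parts against the constant `1`; only the products have to be integrable.
  have h := integral_mul_fderiv_eq_neg_fderiv_mul_of_integrable (𝕜 := ℝ)
    (μ := (volume : Measure (EuclideanSpace ℝ (Fin N)))) (f := fun _ => (1 : ℝ)) (g := f) (v := v)
    (by simp)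
    (by
      simp only [one_mul]
      exact ((hf.continuous_fderiv one_ne_zero).clm_apply continuous_const)
        |>.integrable_of_hasCompactSupport (hc.fderiv_apply (𝕜 := ℝ) v))
    (by
      simp only [one_mul]
      exact hf.continuous.integrable_of_hasCompactSupport hc)
    (by fun_prop) (fun x _ => hf.differentiable one_ne_zero x)
  simpa using h

theorem fderiv_apply_coord {T : EuclideanSpace ℝ (Fin N) → EuclideanSpace ℝ (Fin N)}
    (hT : Differentiable ℝ T) (x v : EuclideanSpace ℝ (Fin N)) (i : Fin N) :
    (fderiv ℝ T x v) i = fderiv ℝ (fun y => T y i) x v := by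
  have h : (fun y => T y i) = (EuclideanSpace.proj (𝕜 := ℝ) i) ∘ T := rfl
  rw [h, ((EuclideanSpace.proj (𝕜 := ℝ) i).hasFDerivAt.comp x (hT x).hasFDerivAt).fderiv]
  rfl

/-- The divergence of a compactly supported field integrates to zero. This allows balls to be
treated as truncations of the whole space. -/
theorem perimeterIn_univ : perimeterIn (Set.univ : Set (EuclideanSpace ℝ (Fin N))) Set.univ = 0 := by
  refine le_antisymm (perimeterIn_le fun T hT => ?_) bot_le
  have hd := hT.contDiff.differentiable one_ne_zero
  have hi : ∀ i : Fin N, ContDiff ℝ 1 fun y => T y i := fun i =>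
    (EuclideanSpace.proj (𝕜 := ℝ) i).contDiff.comp hT.contDiff
  have hci : ∀ i : Fin N, HasCompactSupport fun y => T y i := fun i =>
    hT.hasCompactSupport.comp_left (g := fun z : EuclideanSpace ℝ (Fin N) => z i) rfl
  have : ∫ x, divergence T x = 0 := by
    simp only [divergence, fderiv_apply_coord hd]
    rw [integral_finsetSum]
    · exact Finset.sum_eq_zero fun i _ => integral_fderiv_eq_zero (hi i) (hci i) _
    · intro i _
      exact (((hi i).continuous_fderiv one_ne_zero).clm_apply continuous_const)
        |>.integrable_of_hasCompactSupport ((hci i).fderiv_apply (𝕜 := ℝ) _)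
  simp [this]

theorem divergence_smul {η : EuclideanSpace ℝ (Fin N) → ℝ}
    {T : EuclideanSpace ℝ (Fin N) → EuclideanSpace ℝ (Fin N)}
    {x : EuclideanSpace ℝ (Fin N)} (hη : DifferentiableAt ℝ η x) (hT : DifferentiableAt ℝ T x) :
    divergence (fun y => η y • T y) x = η x * divergence T x + fderiv ℝ η x (T x) := by
  have hb : T x = ∑ i, T x i • EuclideanSpace.single i (1 : ℝ) := by
    simpa using ((EuclideanSpace.basisFun (Fin N) ℝ).sum_repr (T x)).symm
  conv_rhs => rw [hb]
  simp only [divergence, fderiv_fun_smul hη hT, map_sum, map_smul, Finset.mul_sum,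
    ← Finset.sum_add_distrib]
  simp [mul_comm]

theorem IsTestField.smul {Ω : Set (EuclideanSpace ℝ (Fin N))}
    {T : EuclideanSpace ℝ (Fin N) → EuclideanSpace ℝ (Fin N)} (hT : IsTestField Ω T)
    {η : EuclideanSpace ℝ (Fin N) → ℝ} (hη : ContDiff ℝ 1 η) (h0 : ∀ x, 0 ≤ η x)
    (h1 : ∀ x, η x ≤ 1) : IsTestField Ω (fun x => η x • T x) where
  contDiff := hη.smul hT.contDiff
  hasCompactSupport := HasCompactSupport.smul_left (f := η) hT.hasCompactSupport
  tsupport_subset := (tsupport_smul_subset_right η T).trans hT.tsupport_subset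
  norm_le x := by
    rw [norm_smul, Real.norm_of_nonneg (h0 x)]
    exact mul_le_one₀ (h1 x) (norm_nonneg _) (hT.norm_le x)

/-! ### Cutoffs and truncation by balls -/

/-- Integrating against a cutoff increases the perimeter by at most the integral of the gradient
of the cutoff. -/
theorem ofReal_integral_cutoff_le {E A Ω : Set (EuclideanSpace ℝ (Fin N))}
    {T : EuclideanSpace ℝ (Fin N) → EuclideanSpace ℝ (Fin N)} (hT : IsTestField Ω T)
    {η : EuclideanSpace ℝ (Fin N) → ℝ} (hη : ContDiff ℝ 1 η) (h0 : ∀ x, 0 ≤ η x)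
    (h1 : ∀ x, η x ≤ 1) {M : ℝ} (hM : ∀ x, ‖fderiv ℝ η x‖ ≤ M)
    (hA : ∀ x ∉ A, fderiv ℝ η x = 0) (hEm : MeasurableSet E)
    (hfin : volume (E ∩ A) ≠ ∞) :
    ENNReal.ofReal (∫ x in E, η x * divergence T x) ≤
      perimeterIn E Ω + ENNReal.ofReal (M * volume.real (E ∩ A)) := by
  have hd := hη.differentiable one_ne_zero
  have hdT := hT.contDiff.differentiable one_ne_zero
  have hηT := hT.smul hη h0 h1
  have hint : Integrable (fun x => fderiv ℝ η x (T x)) :=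
    ((hη.continuous_fderiv one_ne_zero).clm_apply hT.contDiff.continuous)
      |>.integrable_of_hasCompactSupport <| hT.hasCompactSupport.mono fun x hx h => hx (by simp [h])
  -- Product rule: `η div T = div (η T) - ∇η · T`, where `η T` is again a test field and the
  -- gradient term lives on `A`.
  have key : ∫ x in E, η x * divergence T x =
      (∫ x in E, divergence (fun y => η y • T y) x) - ∫ x in E, fderiv ℝ η x (T x) := by
    rw [← integral_sub hηT.integrable.integrableOn hint.integrableOn]
    refine integral_congr_ae (.of_forall fun x => ?_)
    simp [divergence_smul (hd x) (hdT x)]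
  have hle : ∀ x, ‖fderiv ℝ η x (T x)‖ ≤ M := fun x =>
    ((fderiv ℝ η x).le_opNorm _).trans <|
      (mul_le_of_le_one_right (norm_nonneg _) (hT.norm_le x)).trans (hM x)
  have hEA : ∫ x in E, fderiv ℝ η x (T x) = ∫ x in E ∩ A, fderiv ℝ η x (T x) := by
    refine setIntegral_eq_of_subset_of_forall_sdiff_eq_zero hEm Set.inter_subset_left ?_
    intro x hx
    rw [hA x fun h => hx.2 ⟨hx.1, h⟩]
    rfl
  have hbd : ‖∫ x in E ∩ A, fderiv ℝ η x (T x)‖ ≤ M * volume.real (E ∩ A) :=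
    norm_setIntegral_le_of_norm_le_const hfin.lt_top fun x _ => hle x
  rw [key, hEA, sub_eq_add_neg]
  refine ENNReal.ofReal_add_le.trans (add_le_add (hηT.ofReal_integral_le E) ?_)
  exact ENNReal.ofReal_le_ofReal ((neg_le_abs _).trans hbd)

theorem deriv_smoothTransition_eq_zero {s : ℝ} (hs : s ∉ Set.Ioc (0 : ℝ) 1) :
    deriv Real.smoothTransition s = 0 := by
  rcases le_or_gt s 0 with h | h
  · exact IsLocalMin.deriv_eq_zero (.of_forall fun y => by
      rw [Real.smoothTransition.zero_of_nonpos h]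
      exact Real.smoothTransition.nonneg y)
  · have h1 : 1 ≤ s := by
      by_contra h1
      exact hs ⟨h, (not_le.1 h1).le⟩
    exact IsLocalMax.deriv_eq_zero (.of_forall fun y => by
      rw [Real.smoothTransition.one_of_one_le h1]
      exact Real.smoothTransition.le_one y)

theorem exists_bound_deriv_smoothTransition :
    ∃ K : ℝ, 0 < K ∧ ∀ s, |deriv Real.smoothTransition s| ≤ K := by
  have hc : Continuous (deriv Real.smoothTransition) :=
    (Real.smoothTransition.contDiff (n := 1)).continuous_deriv le_rfl
  obtain ⟨K, hK⟩ := isCompact_Icc.exists_bound_of_continuousOn (s := Set.Icc (0 : ℝ) 1)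
    hc.continuousOn
  refine ⟨max K 1, by positivity, fun s => ?_⟩
  by_cases hs : s ∈ Set.Ioc (0 : ℝ) 1
  · exact (hK s (Set.Ioc_subset_Icc_self hs)).trans (le_max_left _ _)
  · rw [deriv_smoothTransition_eq_zero hs]
    simp

/-- Smooth cutoffs between concentric balls, with gradient controlled by the distance of the
spheres. -/
theorem exists_cutoff : ∃ K : ℝ, 0 < K ∧ ∀ (N : ℕ) (c : EuclideanSpace ℝ (Fin N)) (r s : ℝ),
    0 ≤ r → r < s → ∃ η : EuclideanSpace ℝ (Fin N) → ℝ, ContDiff ℝ 1 η ∧ (∀ x, 0 ≤ η x) ∧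
      (∀ x, η x ≤ 1) ∧ (∀ x ∈ Metric.closedBall c r, η x = 1) ∧
      (∀ x ∉ Metric.closedBall c s, η x = 0) ∧ (∀ x, ‖fderiv ℝ η x‖ ≤ K / (s - r)) ∧
      ∀ x ∉ Metric.closedBall c s \ Metric.closedBall c r, fderiv ℝ η x = 0 := by
  obtain ⟨K, hK, hKb⟩ := exists_bound_deriv_smoothTransition
  refine ⟨2 * K, by positivity, fun N c r s hr hrs => ?_⟩
  have hpos : 0 < s ^ 2 - r ^ 2 := by nlinarith
  -- The squared norm keeps the profile smooth at the centre. The gradient of `q` is at most `2s /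
  -- (s² - r²) ≤ 2 / (s - r)` on the shell, whence the constant `2 * K`.
  let q : EuclideanSpace ℝ (Fin N) → ℝ := fun x => (s ^ 2 - ‖x - c‖ ^ 2) / (s ^ 2 - r ^ 2)
  let η : EuclideanSpace ℝ (Fin N) → ℝ := fun x => Real.smoothTransition (q x)
  have hq : ∀ x, HasFDerivAt q
      ((s ^ 2 - r ^ 2)⁻¹ • -((2 : ℕ) • (innerSL ℝ (x - c) : EuclideanSpace ℝ (Fin N) →L[ℝ] ℝ))) x := fun x => by
    have h1 : HasFDerivAt (fun y : EuclideanSpace ℝ (Fin N) => y - c)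
        (ContinuousLinearMap.id ℝ _) x := (hasFDerivAt_id x).sub_const c
    have h2 := (h1.norm_sq.const_sub (s ^ 2)).const_mul (s ^ 2 - r ^ 2)⁻¹
    have h3 : q = fun y => (s ^ 2 - r ^ 2)⁻¹ * (s ^ 2 - ‖y - c‖ ^ 2) := by
      funext y
      simp only [q, div_eq_inv_mul]
    rw [h3]
    exact h2
  have hone : ∀ x ∈ Metric.closedBall c r, η x = 1 := fun x hx => by
    refine Real.smoothTransition.one_of_one_le ?_
    rw [le_div_iff₀ hpos]
    have := mem_closedBall_iff_norm.1 hx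
    nlinarith [norm_nonneg (x - c)]
  have hzero : ∀ x ∉ Metric.closedBall c s, η x = 0 := fun x hx => by
    refine Real.smoothTransition.zero_of_nonpos ?_
    have := not_le.1 (mt mem_closedBall_iff_norm.2 hx)
    exact div_nonpos_of_nonpos_of_nonneg (by nlinarith) hpos.le
  have h0 : ∀ x, 0 ≤ η x := fun x => Real.smoothTransition.nonneg _
  have h1 : ∀ x, η x ≤ 1 := fun x => Real.smoothTransition.le_one _
  have hA : ∀ x ∉ Metric.closedBall c s \ Metric.closedBall c r, fderiv ℝ η x = 0 := by
    intro x hx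
    by_cases hxs : x ∈ Metric.closedBall c s
    · have hxr : x ∈ Metric.closedBall c r := by
        by_contra h
        exact hx ⟨hxs, h⟩
      exact IsLocalMax.fderiv_eq_zero (.of_forall fun y => by rw [hone x hxr]; exact h1 y)
    · exact IsLocalMin.fderiv_eq_zero (.of_forall fun y => by rw [hzero x hxs]; exact h0 y)
  refine ⟨η, ?_, h0, h1, hone, hzero, fun x => ?_, hA⟩
  · refine Real.smoothTransition.contDiff.comp ?_
    have : ContDiff ℝ 1 fun x : EuclideanSpace ℝ (Fin N) => ‖x - c‖ ^ 2 :=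
      (contDiff_id.sub contDiff_const).norm_sq ℝ
    exact (contDiff_const.sub this).div_const _
  · by_cases hx : x ∈ Metric.closedBall c s \ Metric.closedBall c r
    · have hθ : HasDerivAt Real.smoothTransition (deriv Real.smoothTransition (q x)) (q x) :=
        ((Real.smoothTransition.contDiff (n := 1)).differentiable one_ne_zero _).hasDerivAt
      have hη := hθ.comp_hasFDerivAt x (hq x)
      have hxs := mem_closedBall_iff_norm.1 hx.1
      rw [show fderiv ℝ η x = _ from hη.fderiv, norm_smul, norm_smul, norm_neg,
        two_nsmul, ← two_smul ℝ, norm_smul, innerSL_apply_norm, Real.norm_eq_abs, norm_inv, Real.norm_of_nonneg hpos.le,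
        Real.norm_ofNat]
      calc _ ≤ K * ((s ^ 2 - r ^ 2)⁻¹ * (2 * s)) := by
            gcongr
            exact hKb _
        _ ≤ 2 * K / (s - r) := by
            rw [show s ^ 2 - r ^ 2 = (s - r) * (s + r) by ring, mul_inv]
            have h2 : (s + r)⁻¹ * s ≤ 1 := by
              rw [inv_mul_le_iff₀ (by linarith)]
              linarith
            have h3 : 0 ≤ 2 * K * (s - r)⁻¹ := by
              have : 0 < s - r := by linarith
              positivity
            calc _ = 2 * K * (s - r)⁻¹ * ((s + r)⁻¹ * s) := by ring
              _ ≤ 2 * K * (s - r)⁻¹ := mul_le_of_le_one_right h3 h2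
              _ = _ := by rw [div_eq_mul_inv]
    · rw [hA x hx, norm_zero]
      have : 0 < s - r := by linarith
      positivity

theorem volume_inter_closedBall_ne_top (E : Set (EuclideanSpace ℝ (Fin N)))
    (c : EuclideanSpace ℝ (Fin N)) (r : ℝ) : volume (E ∩ Metric.closedBall c r) ≠ ∞ :=
  ((measure_mono Set.inter_subset_right).trans_lt measure_closedBall_lt_top).ne

/-- Intersecting with a ball increases the perimeter by at most a constant times the growth rate
of the volume inside concentric balls. -/
theorem exists_perimeterIn_inter_closedBall_le : ∃ K : ℝ, 0 < K ∧ ∀ (N : ℕ)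
    (c : EuclideanSpace ℝ (Fin N)) (r : ℝ), 0 ≤ r →
    ∀ (E Ω : Set (EuclideanSpace ℝ (Fin N))), MeasurableSet E → ∀ L : ℝ,
    (∃ᶠ s in 𝓝[>] r, volume.real (E ∩ Metric.closedBall c s) -
      volume.real (E ∩ Metric.closedBall c r) ≤ L * (s - r)) →
    perimeterIn (E ∩ Metric.closedBall c r) Ω ≤ perimeterIn E Ω + ENNReal.ofReal (K * L) := by
  obtain ⟨K, hK, hcut⟩ := exists_cutoff
  refine ⟨K, hK, fun N c r hr E Ω hE L hfreq => perimeterIn_le fun T hT => ?_⟩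
  -- Radii `s k` decreasing to `r` in the limit along which the shell volume is at most `L (s k -
  -- r)`. This cancels the cutoff gradient bound `K / (s k - r)`, while the cutoffs converge to the
  -- indicator of the closed ball.
  obtain ⟨s, hs, hsL⟩ := exists_seq_forall_of_frequently (hfreq.and_eventually self_mem_nhdsWithin)
  have hsr : ∀ k, r < s k := fun k => (hsL k).2
  choose η hη h0 h1 hone hzero hbd hA using fun k => hcut N c r (s k) hr (hsr k)
  have hle : ∀ k, ENNReal.ofReal (∫ x in E, η k x * divergence T x) ≤
      perimeterIn E Ω + ENNReal.ofReal (K * L) := fun k => by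
    have hsub : E ∩ (Metric.closedBall c (s k) \ Metric.closedBall c r) =
        (E ∩ Metric.closedBall c (s k)) \ (E ∩ Metric.closedBall c r) := by
      ext x
      simp only [Set.mem_inter_iff, Set.mem_sdiff]
      tauto
    have hfin : volume (E ∩ (Metric.closedBall c (s k) \ Metric.closedBall c r)) ≠ ∞ :=
      ((measure_mono (Set.inter_subset_inter_right _ Set.sdiff_subset)).trans_lt
        (volume_inter_closedBall_ne_top E c (s k)).lt_top).ne
    refine (ofReal_integral_cutoff_le hT (hη k) (h0 k) (h1 k) (hbd k) (hA k) hE hfin).trans ?_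
    refine add_le_add_right (ENNReal.ofReal_le_ofReal ?_) _
    have hpos : 0 < s k - r := sub_pos.2 (hsr k)
    rw [hsub, measureReal_sdiff
      (Set.inter_subset_inter_right _ (Metric.closedBall_subset_closedBall (hsr k).le))
      (hE.inter measurableSet_closedBall) (volume_inter_closedBall_ne_top E c (s k)),
      div_mul_eq_mul_div, div_le_iff₀ hpos, mul_assoc]
    exact mul_le_mul_of_nonneg_left (hsL k).1 hK.le
  have hlim : Tendsto (fun k => ∫ x in E, η k x * divergence T x) atTop
      (𝓝 (∫ x in E, (Metric.closedBall c r).indicator (divergence T) x)) := by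
    refine tendsto_integral_of_dominated_convergence (fun x => ‖divergence T x‖)
      (fun k => ((hη k).continuous.mul (continuous_divergence hT.contDiff)).aestronglyMeasurable)
      hT.integrable.norm.integrableOn (fun k => .of_forall fun x => ?_) (.of_forall fun x => ?_)
    · rw [norm_mul, Real.norm_of_nonneg (h0 k x)]
      exact mul_le_of_le_one_left (norm_nonneg _) (h1 k x)
    · by_cases hx : x ∈ Metric.closedBall c r
      · simp [hone _ x hx, hx]
      · rw [Set.indicator_of_notMem hx]
        refine tendsto_const_nhds.congr' ?_
        have hx' : r < dist x c := not_le.1 hx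
        filter_upwards [(tendsto_nhds_of_tendsto_nhdsWithin hs).eventually (gt_mem_nhds hx')]
          with k hk
        rw [hzero k x (not_le.2 hk), zero_mul]
  rw [setIntegral_indicator measurableSet_closedBall] at hlim
  exact le_of_tendsto' ((ENNReal.continuous_ofReal.tendsto _).comp hlim) hle

/-- A bounded continuous function has arbitrarily small upper slopes at arbitrarily large points. -/
theorem exists_frequently_slope_le {g : ℝ → ℝ} (hg : Continuous g) {V : ℝ} (h0 : ∀ x, 0 ≤ g x)
    (hV : ∀ x, g x ≤ V) {ε : ℝ} (hε : 0 < ε) (a : ℝ) :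
    ∃ r, a ≤ r ∧ ∃ᶠ s in 𝓝[>] r, g s - g r ≤ ε * (s - r) := by
  by_contra! H
  have H' : ∀ r, a ≤ r → ∀ᶠ s in 𝓝[>] r, ε * (s - r) < g s - g r := fun r hr => by
    simpa only [not_frequently, not_le] using H r hr
  have hV0 : 0 ≤ V := (h0 a).trans (hV a)
  -- If every upper slope beyond `a` exceeded `ε`, then `g` would grow at least at rate `ε / 2` and
  -- gain `V + 1` over length `2 (V + 1) / ε`, exceeding its bound. The rate is halved because the
  -- comparison lemma needs a strict inequality of derivatives.
  have key := image_le_of_liminf_slope_right_lt_deriv_boundary (f := fun x => -g x)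
    (f' := fun _ => -ε) (a := a) (b := a + 2 * (V + 1) / ε) hg.neg.continuousOn
    (fun x hx ρ hρ => by
      refine Eventually.frequently ?_
      filter_upwards [H' x hx.1, self_mem_nhdsWithin] with z hz hxz
      have hpos : 0 < z - x := sub_pos.2 hxz
      rw [slope_def_field, div_lt_iff₀ hpos]
      nlinarith)
    (B := fun x => -g a + -(ε / 2) * (x - a)) (B' := fun _ => -(ε / 2)) (by simp)
    (fun x => by
      simpa using (((hasDerivAt_id x).sub_const a).const_mul (-(ε / 2))).const_add (-g a))
    (fun x _ _ => by linarith)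
  have := key (x := a + 2 * (V + 1) / ε) ⟨by
    have : 0 ≤ 2 * (V + 1) / ε := by positivity
    linarith, le_rfl⟩
  have h3 : ε / 2 * (a + 2 * (V + 1) / ε - a) = V + 1 := by
    field_simp
    ring
  simp only [neg_mul, h3] at this
  linarith [hV (a + 2 * (V + 1) / ε), h0 a]

/-- Spheres are null sets in positive dimension, so the indicators of the balls converge almost
everywhere and dominated convergence applies. -/
theorem continuous_volume_inter_closedBall (hN : 0 < N) (E : Set (EuclideanSpace ℝ (Fin N)))
    (hfin : volume E ≠ ∞) (c : EuclideanSpace ℝ (Fin N)) :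
    Continuous fun r => volume.real (E ∩ Metric.closedBall c r) := by
  have : Nonempty (Fin N) := ⟨⟨0, hN⟩⟩
  have h : ∀ r, volume.real (E ∩ Metric.closedBall c r) =
      ∫ x in E, (Metric.closedBall c r).indicator (fun _ => (1 : ℝ)) x := fun r => by
    rw [setIntegral_indicator measurableSet_closedBall]
    simp
  simp only [h]
  refine continuous_iff_continuousAt.2 fun r => ?_
  refine tendsto_integral_filter_of_dominated_convergence (fun _ => 1)
    (.of_forall fun s => (measurable_const.indicator measurableSet_closedBall).aestronglyMeasurable)
    (.of_forall fun s => .of_forall fun x => ?_) ?_ ?_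
  · by_cases hx : x ∈ Metric.closedBall c s <;> simp [hx]
  · have : IsFiniteMeasure (volume.restrict E) := ⟨by simpa using hfin.lt_top⟩
    exact integrable_const _
  · have hs : ∀ᵐ x ∂volume.restrict E, x ∉ Metric.sphere c r :=
      ae_restrict_of_ae (measure_eq_zero_iff_ae_notMem.1 (Measure.addHaar_sphere _ c r))
    filter_upwards [hs] with x hx
    rcases lt_or_gt_of_ne (show dist x c ≠ r from hx) with h | h
    · refine tendsto_const_nhds.congr' ?_
      filter_upwards [lt_mem_nhds h] with s hs
      rw [Set.indicator_of_mem (Metric.mem_closedBall.2 h.le),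
        Set.indicator_of_mem (Metric.mem_closedBall.2 hs.le)]
    · refine tendsto_const_nhds.congr' ?_
      filter_upwards [gt_mem_nhds h] with s hs
      rw [Set.indicator_of_notMem (fun h' => absurd (Metric.mem_closedBall.1 h') (not_le.2 h)),
        Set.indicator_of_notMem (fun h' => absurd (Metric.mem_closedBall.1 h') (not_le.2 hs))]

/-- A set of finite volume can be truncated by large balls at a small cost in perimeter. -/
theorem exists_truncation (hN : 0 < N) {E Ω : Set (EuclideanSpace ℝ (Fin N))}
    (hE : MeasurableSet E) (hfin : volume E ≠ ∞) (c : EuclideanSpace ℝ (Fin N)) {ε : ℝ}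
    (hε : 0 < ε) (a : ℝ) : ∃ r, 0 ≤ r ∧ a ≤ r ∧
      perimeterIn (E ∩ Metric.closedBall c r) Ω ≤ perimeterIn E Ω + ENNReal.ofReal ε := by
  obtain ⟨K, hK, h⟩ := exists_perimeterIn_inter_closedBall_le
  obtain ⟨r, hr, hf⟩ := exists_frequently_slope_le
    (continuous_volume_inter_closedBall hN E hfin c) (V := volume.real E)
    (fun _ => measureReal_nonneg) (fun _ => measureReal_mono Set.inter_subset_left hfin)
    (div_pos hε hK) (max 0 a)
  refine ⟨r, (le_max_left _ _).trans hr, (le_max_right _ _).trans hr, ?_⟩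
  have := h N c r ((le_max_left _ _).trans hr) E Ω hE _ hf
  rwa [mul_div_cancel₀ _ hK.ne'] at this

/-- In dimension at least two, balls of small volume have small perimeter. -/
theorem exists_small_ball (hN : 2 ≤ N) {ε : ℝ} (hε : 0 < ε) : ∃ δ : ℝ, 0 < δ ∧
    ∀ s, 0 ≤ s → s ≤ δ → ∃ r, ∀ x : EuclideanSpace ℝ (Fin N),
      volume (Metric.closedBall x r) = ENNReal.ofReal s ∧
      perimeterIn (Metric.closedBall x r) Set.univ ≤ ENNReal.ofReal ε := by
  obtain ⟨K, hK, h⟩ := exists_perimeterIn_inter_closedBall_le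
  set ω : ℝ := volume.real (Metric.ball (0 : EuclideanSpace ℝ (Fin N)) 1) with hω
  have hωpos : 0 < ω := by
    rw [hω, measureReal_def]
    exact ENNReal.toReal_pos (Metric.measure_ball_pos _ _ one_pos).ne' measure_ball_lt_top.ne
  have hvol : ∀ (x : EuclideanSpace ℝ (Fin N)) (r : ℝ), 0 ≤ r →
      volume.real (Metric.closedBall x r) = r ^ N * ω := fun x r hr => by
    rw [Measure.addHaar_real_closedBall _ x hr, finrank_euclideanSpace_fin]
  -- The derivative of the ball volume `r ^ N * ω` vanishes at `0` exactly because `N - 1 ≠ 0`;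
  -- truncating the whole space turns this growth rate into a perimeter bound.
  have hsmall : ∀ᶠ r in 𝓝 (0 : ℝ), N * r ^ (N - 1) * ω < ε / K := by
    have hc : Continuous fun r : ℝ => N * r ^ (N - 1) * ω := by fun_prop
    refine (hc.tendsto 0).eventually (gt_mem_nhds ?_)
    rw [zero_pow (by omega)]
    simpa using div_pos hε hK
  obtain ⟨ρ, hρ, hρs⟩ := Metric.eventually_nhds_iff.1 hsmall
  have hρ2 : 0 < ρ / 2 := by positivity
  refine ⟨(ρ / 2) ^ N * ω, by positivity, fun s hs0 hs => ?_⟩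
  obtain ⟨r, hr, hrs⟩ := intermediate_value_Icc hρ2.le
    (f := fun r : ℝ => r ^ N * ω) (by fun_prop) (show s ∈ Set.Icc _ _ from
      ⟨by simpa [show N ≠ 0 by omega] using hs0, hs⟩)
  refine ⟨r, fun x => ⟨?_, ?_⟩⟩
  · replace hrs : r ^ N * ω = s := hrs
    rw [← hrs, ← hvol x r hr.1, measureReal_def, ENNReal.ofReal_toReal measure_closedBall_lt_top.ne]
  · have hder : HasDerivAt (fun r : ℝ => r ^ N * ω) (N * r ^ (N - 1) * ω) r :=
      (hasDerivAt_pow N r).mul_const ω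
    have hlt : N * r ^ (N - 1) * ω < ε / K := hρs (by
      rw [Real.dist_0_eq_abs, abs_of_nonneg hr.1]
      linarith [hr.2])
    have hsl : ∀ᶠ s in 𝓝[>] r, slope (fun r : ℝ => r ^ N * ω) r s < ε / K :=
      ((hasDerivAt_iff_tendsto_slope.1 hder).mono_left
        (nhdsWithin_mono _ fun y hy => (Set.mem_Ioi.1 hy).ne')).eventually (gt_mem_nhds hlt)
    have := h N x r hr.1 Set.univ Set.univ MeasurableSet.univ (ε / K) <| by
      refine Eventually.frequently ?_
      filter_upwards [hsl, self_mem_nhdsWithin] with t ht hrt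
      have hpos : 0 < t - r := sub_pos.2 hrt
      rw [slope_def_field, div_lt_iff₀ hpos] at ht
      rw [Set.univ_inter, Set.univ_inter, hvol x t (hr.1.trans (le_of_lt hrt)), hvol x r hr.1]
      exact ht.le
    rwa [perimeterIn_univ, zero_add, mul_div_cancel₀ _ hK.ne', Set.univ_inter] at this

/-! ### Contractions and locality of the perimeter -/

/-- The homothety of center `c` and ratio `t`, as a homeomorphism. -/
noncomputable def dilation (c : EuclideanSpace ℝ (Fin N)) (t : ℝ) (ht : t ≠ 0) :
    EuclideanSpace ℝ (Fin N) ≃ₜ EuclideanSpace ℝ (Fin N) where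
  toFun x := t • (x - c) + c
  invFun y := t⁻¹ • (y - c) + c
  left_inv x := by simp [smul_smul, ht]
  right_inv y := by simp [smul_smul, ht]
  continuous_toFun := by fun_prop
  continuous_invFun := by fun_prop

theorem dilation_apply (c x : EuclideanSpace ℝ (Fin N)) {t : ℝ} (ht : t ≠ 0) :
    dilation c t ht x = t • (x - c) + c := rfl

theorem hasFDerivAt_dilation (c x : EuclideanSpace ℝ (Fin N)) {t : ℝ} (ht : t ≠ 0) :
    HasFDerivAt (dilation c t ht) (t • ContinuousLinearMap.id ℝ (EuclideanSpace ℝ (Fin N))) x :=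
  (((hasFDerivAt_id x).sub_const c).const_smul t).add_const c

theorem volume_dilation_image (c : EuclideanSpace ℝ (Fin N)) {t : ℝ} (ht : 0 < t)
    (E : Set (EuclideanSpace ℝ (Fin N))) :
    volume (dilation c t ht.ne' '' E) = ENNReal.ofReal (t ^ N) * volume E := by
  have h := Measure.addHaar_image_homothety (volume : Measure (EuclideanSpace ℝ (Fin N))) c t E
  rw [finrank_euclideanSpace_fin, abs_of_nonneg (pow_nonneg ht.le _)] at h
  exact h

theorem setIntegral_dilation_image (c : EuclideanSpace ℝ (Fin N)) {t : ℝ} (ht : 0 < t)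
    {E : Set (EuclideanSpace ℝ (Fin N))} (hE : MeasurableSet E)
    (g : EuclideanSpace ℝ (Fin N) → ℝ) :
    ∫ x in dilation c t ht.ne' '' E, g x = t ^ N * ∫ x in E, g (dilation c t ht.ne' x) := by
  rw [integral_image_eq_integral_abs_det_fderiv_smul volume hE
    (fun x _ => (hasFDerivAt_dilation c x ht.ne').hasFDerivWithinAt)
    (dilation c t ht.ne').injective.injOn]
  have hdet : (t • ContinuousLinearMap.id ℝ (EuclideanSpace ℝ (Fin N))).det = t ^ N := by
    simp [ContinuousLinearMap.det, LinearMap.det_smul]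
  simp only [hdet, abs_of_nonneg (pow_nonneg ht.le N), smul_eq_mul]
  rw [integral_const_mul]

/-- Contractions do not increase the relative perimeter. -/
theorem perimeterIn_dilation_image_le (hN : 0 < N) (c : EuclideanSpace ℝ (Fin N)) {t : ℝ}
    (ht : 0 < t) (ht1 : t ≤ 1) {E : Set (EuclideanSpace ℝ (Fin N))} (hE : MeasurableSet E)
    (C : Set (EuclideanSpace ℝ (Fin N))) :
    perimeterIn (dilation c t ht.ne' '' E) (dilation c t ht.ne' '' C)ᶜ ≤ perimeterIn E Cᶜ := by
  refine perimeterIn_le fun T hT => ?_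
  set φ := dilation c t ht.ne' with hφ
  have hdiv : ∀ x, divergence (T ∘ φ) x = t * divergence T (φ x) := fun x => by
    have h := ((hT.contDiff.differentiable one_ne_zero (φ x)).hasFDerivAt.comp x
      (hasFDerivAt_dilation c x ht.ne')).fderiv
    simp only [divergence, h, Finset.mul_sum]
    simp
  have hS : IsTestField Cᶜ (T ∘ φ) := by
    refine ⟨hT.contDiff.comp ?_, hT.hasCompactSupport.comp_homeomorph φ, fun x hx hxC => ?_,
      fun x => hT.norm_le _⟩
    · change ContDiff ℝ 1 fun x => t • (x - c) + c
      fun_prop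
    · exact hT.tsupport_subset (tsupport_comp_subset_preimage T φ.continuous hx)
        (Set.mem_image_of_mem φ hxC)
  -- The Jacobian contributes `t ^ N`, and the chain rule for the divergence takes back one factor
  -- `t`.
  have hint : ∫ x in φ '' E, divergence T x = t ^ (N - 1) * ∫ x in E, divergence (T ∘ φ) x := by
    rw [hφ, setIntegral_dilation_image c ht hE, ← hφ]
    simp only [hdiv]
    rw [integral_const_mul, ← mul_assoc, ← pow_succ, Nat.sub_add_cancel hN]
  rw [hint, ENNReal.ofReal_mul (by positivity)]
  refine (mul_le_of_le_one_left zero_le ?_).trans (hS.ofReal_integral_le E)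
  exact ENNReal.ofReal_le_one.2 (pow_le_one₀ ht.le ht1)

/-- For sets inside a ball, the perimeter in `Ω` only depends on `Ω` near that ball. -/
theorem perimeterIn_le_of_subset_closedBall {E Ω Ω' : Set (EuclideanSpace ℝ (Fin N))}
    (hE : MeasurableSet E) {c : EuclideanSpace ℝ (Fin N)} {r s : ℝ} (hr : 0 ≤ r) (hrs : r < s)
    (hEr : E ⊆ Metric.closedBall c r) (h : Ω ∩ Metric.closedBall c s ⊆ Ω') :
    perimeterIn E Ω ≤ perimeterIn E Ω' := by
  obtain ⟨K, -, hcut⟩ := exists_cutoff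
  obtain ⟨η, hη, h0, h1, hone, hzero, -, hA⟩ := hcut N c r s hr hrs
  refine perimeterIn_le fun T hT => ?_
  have hS := hT.smul hη h0 h1
  have hS' : IsTestField Ω' fun x => η x • T x := by
    refine ⟨hS.contDiff, hS.hasCompactSupport, fun x hx => h ⟨hS.tsupport_subset hx, ?_⟩,
      hS.norm_le⟩
    refine closure_minimal (fun y hy => ?_) Metric.isClosed_closedBall hx
    by_contra hys
    exact hy (by simp [hzero y hys])
  have heq : ∫ x in E, divergence T x = ∫ x in E, divergence (fun y => η y • T y) x := by
    refine setIntegral_congr_fun hE fun x hx => ?_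
    -- The gradient vanishes on the whole closed inner ball, boundary sphere included, so `E` may
    -- touch that sphere.
    have hd : fderiv ℝ η x = 0 := hA x fun h => h.2 (hEr hx)
    simp [divergence_smul (hη.differentiable one_ne_zero x)
      (hT.contDiff.differentiable one_ne_zero x), hone x (hEr hx), hd]
  rw [heq]
  exact hS'.ofReal_integral_le E

/-! ### Consequences of Kuratowski convergence -/

/-- Fatou's lemma for sets. -/
theorem eventually_lt_measure {α : Type*} [MeasurableSpace α] {μ : Measure α} {S : Set α}
    {B : ℕ → Set α} (hS : MeasurableSet S) (hB : ∀ n, MeasurableSet (B n))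
    (h : ∀ x ∈ S, ∀ᶠ n in atTop, x ∈ B n) {a : ℝ≥0∞} (ha : a < μ S) :
    ∀ᶠ n in atTop, a < μ (B n) := by
  refine eventually_lt_of_lt_liminf (ha.trans_le ?_)
  calc μ S = ∫⁻ x, S.indicator 1 x ∂μ := (lintegral_indicator_one hS).symm
    _ ≤ ∫⁻ x, liminf (fun n => (B n).indicator 1 x) atTop ∂μ := by
      refine lintegral_mono fun x => ?_
      by_cases hx : x ∈ S
      · refine le_liminf_of_le (by isBoundedDefault) ?_
        filter_upwards [h x hx] with n hn
        simp [hx, hn]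
      · simp [hx]
    _ ≤ liminf (fun n => ∫⁻ x, (B n).indicator 1 x ∂μ) atTop :=
      lintegral_liminf_le fun n => measurable_one.indicator (hB n)
    _ = liminf (fun n => μ (B n)) atTop := by
      simp only [lintegral_indicator_one (hB _)]

theorem KuratowskiTendsto.eventually_notMem {F : ℕ → Set (EuclideanSpace ℝ (Fin N))}
    {C : Set (EuclideanSpace ℝ (Fin N))} (h : KuratowskiTendsto F C)
    (hne : ∀ n, (F n).Nonempty) {x : EuclideanSpace ℝ (Fin N)} (hx : x ∉ C) :
    ∀ᶠ n in atTop, x ∉ F n := by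
  classical
  by_contra hf
  rw [not_eventually] at hf
  -- If `x` lies in infinitely many `F n`, choosing `x` there and an arbitrary point of `F n`
  -- otherwise makes `x` a limit point.
  refine hx (h.1 (fun n => if x ∈ F n then x else (hne n).some) (fun n => ?_) x ?_)
  · split_ifs with hn
    · exact hn
    · exact (hne n).some_mem
  · refine mapClusterPt_iff_frequently.2 fun s hs => hf.mono fun n hn => ?_
    simpa [not_not.1 hn] using mem_of_mem_nhds hs

/-- Hahn–Banach separation with a normalized normal, so that normals can be extracted from the
compact unit sphere. -/
theorem exists_norm_eq_one_separating {C : Set (EuclideanSpace ℝ (Fin N))} (hC : Convex ℝ C)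
    (hcl : IsClosed C) (hne : C.Nonempty) {x : EuclideanSpace ℝ (Fin N)} (hx : x ∉ C) :
    ∃ u : EuclideanSpace ℝ (Fin N), ‖u‖ = 1 ∧ ∃ δ : ℝ, 0 < δ ∧
      ∀ y ∈ C, inner ℝ u (y - x) ≤ -δ := by
  obtain ⟨f, a, hf, ha⟩ := geometric_hahn_banach_closed_point hC hcl hx
  obtain ⟨w, rfl⟩ := (InnerProductSpace.toDual ℝ _).surjective f
  simp only [InnerProductSpace.toDual_apply_apply] at hf ha
  have hw : w ≠ 0 := by
    rintro rfl
    obtain ⟨y, hy⟩ := hne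
    have := hf y hy
    simp only [inner_zero_left] at this ha
    linarith
  have hwn : 0 < ‖w‖ := norm_pos_iff.2 hw
  refine ⟨‖w‖⁻¹ • w, norm_smul_inv_norm hw, (inner ℝ w x - a) / ‖w‖,
    div_pos (by linarith) hwn, fun y hy => ?_⟩
  rw [real_inner_smul_left, inner_sub_right, ← neg_div, inv_mul_eq_div]
  gcongr
  linarith [hf y hy]

/-- Otherwise points of `K` are separated from `F n` for infinitely many `n`. A limit of these
points and of the unit normals gives a hyperplane supporting `C` at an interior point, which is
impossible. -/
theorem KuratowskiTendsto.eventually_subset {F : ℕ → Set (EuclideanSpace ℝ (Fin N))}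
    {C : Set (EuclideanSpace ℝ (Fin N))} (h : KuratowskiTendsto F C)
    (hF : ∀ n, Convex ℝ (F n)) (hcl : ∀ n, IsClosed (F n)) (hne : ∀ n, (F n).Nonempty)
    {K : Set (EuclideanSpace ℝ (Fin N))} (hK : IsCompact K) (hKC : K ⊆ interior C) :
    ∀ᶠ n in atTop, K ⊆ F n := by
  by_contra hf
  rw [not_eventually] at hf
  obtain ⟨φ, hφ, hnot⟩ := extraction_of_frequently_atTop hf
  simp only [Set.not_subset] at hnot
  choose x hxK hxF using hnot
  choose u hu δ hδ hsep using fun k =>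
    exists_norm_eq_one_separating (hF (φ k)) (hcl (φ k)) (hne (φ k)) (hxF k)
  obtain ⟨⟨x₀, u₀⟩, hmem, ψ, hψ, hlim⟩ :=
    (hK.prod (isCompact_sphere (0 : EuclideanSpace ℝ (Fin N)) 1)).tendsto_subseq
      (x := fun k => (x k, u k)) fun k => ⟨hxK k, by simp [hu k]⟩
  have hx₀ : Tendsto (fun k => x (ψ k)) atTop (𝓝 x₀) := (continuous_fst.tendsto _).comp hlim
  have hu₀ : Tendsto (fun k => u (ψ k)) atTop (𝓝 u₀) := (continuous_snd.tendsto _).comp hlim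
  have hu1 : ‖u₀‖ = 1 := by simpa using hmem.2
  -- The gaps `δ k` may tend to zero, so only the weak inequality survives in the limit; it suffices
  -- at an interior point.
  have hC : ∀ y ∈ C, inner ℝ u₀ (y - x₀) ≤ 0 := fun y hy => by
    obtain ⟨z, hzF, hz⟩ := h.2 y hy
    have hz' : Tendsto (fun k => z (φ (ψ k))) atTop (𝓝 y) :=
      hz.comp (hφ.comp hψ).tendsto_atTop
    exact le_of_tendsto' (hu₀.inner (hz'.sub hx₀)) fun k =>
      (hsep (ψ k) _ (hzF _)).trans (neg_nonpos.2 (hδ _).le)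
  obtain ⟨ε, hε, hball⟩ := Metric.isOpen_iff.1 isOpen_interior x₀ (hKC hmem.1)
  have := hC (x₀ + (ε / 2) • u₀) (interior_subset (hball (by
    simpa [norm_smul, hu1, abs_of_pos hε] using hε)))
  rw [add_sub_cancel_left, real_inner_smul_right, real_inner_self_eq_norm_sq, hu1] at this
  linarith

/-! ### Geometry outside a convex body -/

/-- The complement of a proper closed convex set contains balls of any radius far away. -/
theorem exists_far_ball {C : Set (EuclideanSpace ℝ (Fin N))} (hC : IsConvexBody C)
    (c : EuclideanSpace ℝ (Fin N)) (R r : ℝ) : ∃ x, Metric.closedBall x r ⊆ Cᶜ ∧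
      Disjoint (Metric.closedBall c R) (Metric.closedBall x r) := by
  obtain ⟨p, hp⟩ := (Set.ne_univ_iff_exists_notMem C).1 hC.2.2.2
  obtain ⟨u, hu, δ, hδ, hsep⟩ := exists_norm_eq_one_separating hC.2.1 hC.1
    (hC.2.2.1.mono interior_subset) hp
  have huu : inner ℝ u u = (1 : ℝ) := by rw [real_inner_self_eq_norm_sq, hu, one_pow]
  -- The first bound keeps the ball on the far side of the separating hyperplane, the second pushes
  -- it past the ball of radius `R` about `c`.
  set t : ℝ := max r (R + r + 1 + ‖p - c‖) with ht
  have hb : ∀ y : EuclideanSpace ℝ (Fin N), |inner ℝ u y| ≤ ‖y‖ := fun y => by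
    simpa [hu] using abs_real_inner_le_norm u y
  refine ⟨p + t • u, fun y hy hyC => ?_, ?_⟩
  · have h1 := hsep y hyC
    have h2 := (neg_le_abs _).trans ((hb _).trans (mem_closedBall_iff_norm.1 hy))
    rw [show y - (p + t • u) = (y - p) - t • u by abel, inner_sub_right, real_inner_smul_right,
      huu] at h2
    linarith [le_max_left r (R + r + 1 + ‖p - c‖)]
  · rw [Set.disjoint_left]
    intro y hy hy'
    have h2 := (neg_le_abs _).trans ((hb _).trans (mem_closedBall_iff_norm.1 hy'))
    have h3 := (le_abs_self _).trans ((hb _).trans (mem_closedBall_iff_norm.1 hy))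
    have h4 := (neg_le_abs _).trans (hb (p - c))
    rw [show y - (p + t • u) = (y - c) - (p - c) - t • u by abel, inner_sub_right,
      real_inner_smul_right, huu, inner_sub_right] at h2
    linarith [le_max_right r (R + r + 1 + ‖p - c‖)]

theorem dilation_image_subset_interior {C : Set (EuclideanSpace ℝ (Fin N))} (hC : Convex ℝ C)
    {c : EuclideanSpace ℝ (Fin N)} (hc : c ∈ interior C) {t : ℝ} (ht : 0 < t) (ht1 : t < 1) :
    dilation c t ht.ne' '' C ⊆ interior C := by
  rintro _ ⟨x, hx, rfl⟩
  have := hC.combo_interior_self_mem_interior hc hx (a := 1 - t) (b := t) (by linarith) ht.le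
    (by ring)
  rw [dilation_apply]
  convert! this using 1
  rw [smul_sub, sub_smul, one_smul]
  abel

/-- Slight contractions of a set outside `C` stay outside `C` up to a small volume. -/
theorem exists_dilation_volume_lt {C E : Set (EuclideanSpace ℝ (Fin N))} (hC : IsClosed C)
    (hE : MeasurableSet E) (hEC : E ⊆ Cᶜ) (c : EuclideanSpace ℝ (Fin N)) {a : ℝ≥0∞}
    (ha : a < volume E) : ∃ (t : ℝ) (ht : 0 < t), t < 1 ∧
      a < volume (dilation c t ht.ne' '' E \ C) := by
  obtain ⟨b, hab, hb⟩ := exists_between ha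
  -- The shift by `2` keeps the ratio positive already at `k = 0`.
  let t : ℕ → ℝ := fun k => 1 - 1 / ((k : ℝ) + 2)
  have ht : ∀ k, 0 < t k := fun k => by
    have : 1 / ((k : ℝ) + 2) < 1 := by
      rw [div_lt_one (by positivity)]
      have : (0 : ℝ) ≤ k := k.cast_nonneg
      linarith
    simpa [t] using this
  have ht1 : ∀ k, t k < 1 := fun k => by
    have : 0 < 1 / ((k : ℝ) + 2) := by positivity
    simp only [t]
    linarith
  have htlim : Tendsto t atTop (𝓝 1) := by
    have h : Tendsto (fun k : ℕ => 1 / ((k : ℝ) + 2)) atTop (𝓝 0) :=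
      tendsto_const_nhds.div_atTop (tendsto_natCast_atTop_atTop.atTop_add tendsto_const_nhds)
    simpa [t] using h.const_sub 1
  -- Since `C` is closed, each point of `E` stays outside `C` under contractions close to the
  -- identity. The room between `a` and `b` absorbs the volume factor `t k ^ N`.
  have h1 : ∀ᶠ k in atTop, b < volume (E \ (dilation c (t k) (ht k).ne' ⁻¹' C)) := by
    refine eventually_lt_measure hE
      (fun k => hE.diff ((dilation c (t k) (ht k).ne').measurable hC.measurableSet))
      (fun x hx => ?_) hb
    have hlim : Tendsto (fun k => dilation c (t k) (ht k).ne' x) atTop (𝓝 x) := by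
      simp only [dilation_apply]
      simpa using (htlim.smul_const (x - c)).add_const c
    filter_upwards [hlim.eventually (hC.isOpen_compl.mem_nhds (hEC hx))] with k hk
    exact ⟨hx, hk⟩
  have h2 : Tendsto (fun k => ENNReal.ofReal (t k ^ N) * b) atTop (𝓝 b) := by
    have h3 : Tendsto (fun k => ENNReal.ofReal (t k ^ N)) atTop (𝓝 1) := by
      simpa using ENNReal.tendsto_ofReal (htlim.pow N)
    simpa using ENNReal.Tendsto.mul_const h3 (Or.inl one_ne_zero)
  obtain ⟨k, hk1, hk2⟩ := (h1.and (h2.eventually (lt_mem_nhds hab))).exists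
  refine ⟨t k, ht k, ht1 k, hk2.trans_le ?_⟩
  have : dilation c (t k) (ht k).ne' '' E \ C =
      dilation c (t k) (ht k).ne' '' (E \ (dilation c (t k) (ht k).ne' ⁻¹' C)) := by
    rw [Set.image_sdiff_preimage]
  rw [this, volume_dilation_image c (ht k)]
  gcongr

/-! ### Dimension at least two -/

/-- Upper semicontinuity along a fixed competitor, in dimension at least two. -/
theorem eventually_exteriorProfile_le (hN : 2 ≤ N) {Cs : ℕ → Set (EuclideanSpace ℝ (Fin N))}
    {C : Set (EuclideanSpace ℝ (Fin N))} (hCs : ∀ n, IsConvexBody (Cs n)) (hC : IsConvexBody C)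
    (hconv : KuratowskiTendsto Cs C) {v : ℝ} (hv : 0 < v) {E : Set (EuclideanSpace ℝ (Fin N))}
    (hE : MeasurableSet E) (hEC : E ⊆ Cᶜ) (hEv : volume E = ENNReal.ofReal v) {ε : ℝ}
    (hε : 0 < ε) :
    ∀ᶠ n in atTop, exteriorProfile (Cs n) v ≤ perimeterIn E Cᶜ + ENNReal.ofReal ε := by
  have hne : ∀ n, (Cs n).Nonempty := fun n => (hCs n).2.2.1.mono interior_subset
  have hN0 : 0 < N := by omega
  -- Half of `ε` pays for the added ball, the other half for the truncation; `δ` is the volume the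
  -- ball can supply.
  obtain ⟨δ, hδ, hsmall⟩ := exists_small_ball hN (half_pos hε)
  obtain ⟨c, hc⟩ := hC.2.2.1
  have hfin : volume E ≠ ∞ := by rw [hEv]; exact ENNReal.ofReal_ne_top
  have hlt : ENNReal.ofReal (v - δ) < volume E := by
    rw [hEv]
    exact (ENNReal.ofReal_lt_ofReal_iff hv).2 (by linarith)
  obtain ⟨k, hk⟩ := (eventually_lt_measure hE
    (fun k : ℕ => hE.inter (measurableSet_closedBall (x := c) (ε := (k : ℝ))))
    (fun x hx => by
      filter_upwards [eventually_ge_atTop ⌈dist x c⌉₊] with k hk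
      exact ⟨hx, Metric.mem_closedBall.2 (Nat.ceil_le.1 hk)⟩) hlt).exists
  obtain ⟨R, hR0, hkR, hER⟩ := exists_truncation hN0 (Ω := Cᶜ) hE hfin c (half_pos hε) (k : ℝ)
  set G := E ∩ Metric.closedBall c R with hG
  have hGm : MeasurableSet G := hE.inter measurableSet_closedBall
  have hGv : ENNReal.ofReal (v - δ) < volume G := hk.trans_le <| measure_mono <|
    Set.inter_subset_inter_right _ (Metric.closedBall_subset_closedBall hkR)
  obtain ⟨t, ht, ht1, hvt⟩ := exists_dilation_volume_lt hC.1 hGm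
    (Set.inter_subset_left.trans hEC) c hGv
  set φ := dilation c t ht.ne' with hφ
  have hφG : MeasurableSet (φ '' G) := φ.measurableEmbedding.measurableSet_image.2 hGm
  have hφGR : φ '' G ⊆ Metric.closedBall c R := by
    rintro _ ⟨x, hx, rfl⟩
    have := mem_closedBall_iff_norm.1 hx.2
    rw [mem_closedBall_iff_norm, hφ, dilation_apply, add_sub_cancel_right, norm_smul,
      Real.norm_of_nonneg ht.le]
    exact (mul_le_of_le_one_left (norm_nonneg _) ht1.le).trans this
  have hφGv : volume (φ '' G) ≤ ENNReal.ofReal v := by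
    rw [hφ, volume_dilation_image c ht, ← hEv]
    calc _ ≤ 1 * volume G := by
          gcongr
          exact ENNReal.ofReal_le_one.2 (pow_le_one₀ ht.le ht1.le)
      _ ≤ volume E := by
          rw [one_mul]
          exact measure_mono Set.inter_subset_left
  have hvol : ∀ᶠ n in atTop, ENNReal.ofReal (v - δ) < volume (φ '' G \ Cs n) := by
    refine eventually_lt_measure (hφG.diff hC.1.measurableSet)
      (fun n => hφG.diff (hCs n).1.measurableSet) (fun x hx => ?_) hvt
    filter_upwards [hconv.eventually_notMem hne hx.2] with n hn
    exact ⟨hx.1, hn⟩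
  -- Radius `R + 1` leaves room for the cutoff around the ball of radius `R` containing the
  -- competitor.
  have hcpt : IsCompact (φ '' C ∩ Metric.closedBall c (R + 1)) :=
    (isCompact_closedBall c (R + 1)).inter_left (φ.isClosed_image.2 hC.1)
  have hsub := hconv.eventually_subset (fun n => (hCs n).2.1) (fun n => (hCs n).1) hne hcpt
    (Set.inter_subset_left.trans (dilation_image_subset_interior hC.2.1 hc ht ht1))
  filter_upwards [hvol, hsub] with n hn hnC
  set F := φ '' G \ Cs n with hF
  have hFm : MeasurableSet F := hφG.diff (hCs n).1.measurableSet
  have hFv : volume F ≤ ENNReal.ofReal v := (measure_mono Set.sdiff_subset).trans hφGv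
  have hFfin : volume F ≠ ∞ := (hFv.trans_lt ENNReal.ofReal_lt_top).ne
  have hF1 : volume.real F ≤ v := ENNReal.toReal_le_of_le_ofReal hv.le hFv
  have hF2 : v - δ ≤ volume.real F := (ENNReal.ofReal_le_iff_le_toReal hFfin).1 hn.le
  obtain ⟨r, hr⟩ := hsmall (v - volume.real F) (by linarith) (by linarith)
  obtain ⟨x, hxC, hxR⟩ := exists_far_ball (hCs n) c R r
  have hdisj : Disjoint F (Metric.closedBall x r) :=
    hxR.mono_left (Set.sdiff_subset.trans hφGR)
  have hPF : perimeterIn F (Cs n)ᶜ ≤ perimeterIn E Cᶜ + ENNReal.ofReal (ε / 2) := by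
    calc perimeterIn F (Cs n)ᶜ ≤ perimeterIn (φ '' G) (Cs n)ᶜ :=
          perimeterIn_diff_le hφG disjoint_compl_right
      _ ≤ perimeterIn (φ '' G) (φ '' C)ᶜ :=
          perimeterIn_le_of_subset_closedBall hφG hR0 (lt_add_one R) hφGR
            fun y hy hyC => hy.1 (hnC ⟨hyC, hy.2⟩)
      _ ≤ perimeterIn G Cᶜ := perimeterIn_dilation_image_le hN0 c ht ht1.le hGm C
      _ ≤ _ := hER
  calc exteriorProfile (Cs n) v ≤ perimeterIn (F ∪ Metric.closedBall x r) (Cs n)ᶜ := by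
        refine exteriorProfile_le (hFm.union measurableSet_closedBall)
          (Set.union_subset (fun y hy => hy.2) hxC) ?_
        rw [measure_union hdisj measurableSet_closedBall, (hr x).1,
          ← ENNReal.ofReal_toReal hFfin, ← ENNReal.ofReal_add ENNReal.toReal_nonneg
          (sub_nonneg.2 hF1)]
        simp [measureReal_def]
    _ ≤ perimeterIn F (Cs n)ᶜ + perimeterIn (Metric.closedBall x r) (Cs n)ᶜ :=
        perimeterIn_union_le hdisj measurableSet_closedBall
    _ ≤ (perimeterIn E Cᶜ + ENNReal.ofReal (ε / 2)) + ENNReal.ofReal (ε / 2) :=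
        add_le_add hPF ((perimeterIn_mono (Set.subset_univ _)).trans (hr x).2)
    _ = perimeterIn E Cᶜ + ENNReal.ofReal ε := by
        rw [add_assoc, ← ENNReal.ofReal_add (by positivity) (by positivity), add_halves]

theorem limsup_exteriorProfile_le (hN : 2 ≤ N) {Cs : ℕ → Set (EuclideanSpace ℝ (Fin N))}
    {C : Set (EuclideanSpace ℝ (Fin N))} (hCs : ∀ n, IsConvexBody (Cs n)) (hC : IsConvexBody C)
    (hconv : KuratowskiTendsto Cs C) {v : ℝ} (hv : 0 < v) :
    limsup (fun n => exteriorProfile (Cs n) v) atTop ≤ exteriorProfile C v := by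
  refine le_iInf fun E => le_iInf fun hE => le_iInf fun hEC => le_iInf fun hEv => ?_
  refine ENNReal.le_of_forall_pos_le_add fun ε hε _ => ?_
  refine limsup_le_of_le (by isBoundedDefault) ?_
  simpa using eventually_exteriorProfile_le hN hCs hC hconv hv hE hEC hEv (NNReal.coe_pos.2 hε)

/-! ### Dimension one -/

/-- Arc-length parametrizations of the one-dimensional Euclidean space. -/
theorem exists_isometryEquiv_line (x₀ : EuclideanSpace ℝ (Fin 1)) {u : EuclideanSpace ℝ (Fin 1)}
    (hu : ‖u‖ = 1) : ∃ Φ : ℝ ≃ᵢ EuclideanSpace ℝ (Fin 1),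
      (∀ s, Φ s = x₀ + s • u) ∧ MeasurePreserving Φ := by
  let L : ℝ ≃ₗᵢ[ℝ] EuclideanSpace ℝ (Fin 1) :=
    (LinearIsometry.toSpanSingleton ℝ (EuclideanSpace ℝ (Fin 1)) hu).toLinearIsometryEquiv
      (by simp)
  refine ⟨L.toIsometryEquiv.trans (IsometryEquiv.addLeft x₀), fun s => rfl, ?_⟩
  exact (measurePreserving_add_left volume x₀).comp L.measurePreserving

theorem divergence_eq_inner {T : EuclideanSpace ℝ (Fin 1) → EuclideanSpace ℝ (Fin 1)}
    {x u : EuclideanSpace ℝ (Fin 1)} (hu : ‖u‖ = 1) :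
    divergence T x = inner ℝ u (fderiv ℝ T x u) := by
  have h1 : u 0 * u 0 = 1 := by
    have := EuclideanSpace.real_norm_sq_eq u
    simp [hu] at this
    nlinarith
  have h2 : u = u 0 • EuclideanSpace.single 0 (1 : ℝ) := by
    ext i
    fin_cases i
    simp
  have h3 : fderiv ℝ T x u = u 0 • fderiv ℝ T x (EuclideanSpace.single 0 (1 : ℝ)) := by
    conv_lhs => rw [h2]
    rw [map_smul]
  rw [h3]
  simp only [divergence, Finset.univ_unique, Fin.default_eq_zero, Finset.sum_singleton,
    PiLp.inner_apply, PiLp.smul_apply, smul_eq_mul]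
  simp only [RCLike.inner_apply, conj_trivial]
  linear_combination (-(fderiv ℝ T x (EuclideanSpace.single 0 (1 : ℝ))) 0) * h1

theorem hasDerivAt_inner_line {T : EuclideanSpace ℝ (Fin 1) → EuclideanSpace ℝ (Fin 1)}
    (hT : ContDiff ℝ 1 T) {u : EuclideanSpace ℝ (Fin 1)} (hu : ‖u‖ = 1)
    (x₀ : EuclideanSpace ℝ (Fin 1)) (s : ℝ) :
    HasDerivAt (fun s : ℝ => inner ℝ u (T (x₀ + s • u))) (divergence T (x₀ + s • u)) s := by
  have h1 : HasDerivAt (fun s : ℝ => x₀ + s • u) u s := by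
    simpa using ((hasDerivAt_id s).smul_const u).const_add x₀
  have h2 := (hT.differentiable one_ne_zero (x₀ + s • u)).hasFDerivAt.comp_hasDerivAt s h1
  rw [divergence_eq_inner hu]
  simpa using (hasDerivAt_const s u).inner ℝ h2

/-- In dimension one the exterior isoperimetric profile is at most one. -/
theorem exteriorProfile_le_one {C : Set (EuclideanSpace ℝ (Fin 1))} (hC : IsConvexBody C) {v : ℝ}
    (hv : 0 < v) : exteriorProfile C v ≤ 1 := by
  obtain ⟨p, hp⟩ := (Set.ne_univ_iff_exists_notMem C).1 hC.2.2.2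
  obtain ⟨b, hb, hpb⟩ := hC.1.exists_infDist_eq_dist (hC.2.2.1.mono interior_subset) p
  have hd : 0 < ‖p - b‖ := norm_pos_iff.2 (sub_ne_zero.2 fun h => hp (h ▸ hb))
  set d := ‖p - b‖ with hd'
  set u := d⁻¹ • (p - b) with hu'
  have hu : ‖u‖ = 1 := norm_smul_inv_norm (sub_ne_zero.2 fun h => hp (h ▸ hb))
  have hpu : p = b + d • u := by
    rw [hu', smul_smul, mul_inv_cancel₀ hd.ne', one_smul]
    abel
  clear_value u d
  -- `b` is a point of `C` nearest to `p`. A point of `C` on the ray beyond `p` would force `p ∈ C`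
  -- by convexity; one before `p` would be nearer to `p` than `b`.
  have hray : ∀ t : ℝ, 0 < t → b + t • u ∉ C := fun t ht htC => by
    rcases le_or_gt d t with h | h
    · refine hp ?_
      have := hC.2.1 hb htC
        (show 0 ≤ 1 - d / t from sub_nonneg.2 ((div_le_one ht).2 h))
        (show 0 ≤ d / t by positivity) (by ring)
      convert! this using 1
      rw [hpu, smul_add, smul_smul, div_mul_cancel₀ _ ht.ne', sub_smul, one_smul]
      abel
    · have h1 := Metric.infDist_le_dist_of_mem (x := p) htC
      rw [hpb, dist_eq_norm, dist_eq_norm, ← hd'] at h1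
      nth_rewrite 1 [hpu] at h1
      rw [show b + d • u - (b + t • u) = (d - t) • u by rw [sub_smul]; abel, norm_smul, hu,
        mul_one, Real.norm_of_nonneg (by linarith)] at h1
      linarith
  obtain ⟨Φ, hΦ, hmp⟩ := exists_isometryEquiv_line b hu
  have hme : MeasurableEmbedding Φ := Φ.toHomeomorph.measurableEmbedding
  have hEm : MeasurableSet (Φ '' Set.Ioc 0 v) := hme.measurableSet_image.2 measurableSet_Ioc
  have hpre : Φ ⁻¹' (Φ '' Set.Ioc 0 v) = Set.Ioc 0 v := Set.preimage_image_eq _ Φ.injective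
  refine (exteriorProfile_le hEm ?_ ?_).trans (perimeterIn_le fun T hT => ?_)
  · rintro _ ⟨t, ht, rfl⟩
    rw [hΦ]
    exact hray t ht.1
  · rw [← hmp.measure_preimage_emb hme, hpre]
    simp
  · rw [← hmp.setIntegral_preimage_emb hme, hpre]
    simp only [hΦ]
    rw [← intervalIntegral.integral_of_le hv.le,
      intervalIntegral.integral_eq_sub_of_hasDerivAt
        (fun s _ => hasDerivAt_inner_line hT.contDiff hu b s)
        (((continuous_divergence hT.contDiff).comp (by fun_prop)).intervalIntegrable _ _)]
    -- The endpoint `b` lies in `C`, so only the other endpoint of the interval contributes.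
    have hTb : T b = 0 := image_eq_zero_of_notMem_tsupport fun h => hT.tsupport_subset h hb
    rw [zero_smul, add_zero, hTb, inner_zero_right, sub_zero]
    refine ENNReal.ofReal_le_one.2 ((real_inner_le_norm _ _).trans ?_)
    rw [hu, one_mul]
    exact hT.norm_le _

/-- A set of finite measure in the line with density close to one near the origin admits a test
function supported in the positive half-line whose derivative has integral close to one. -/
theorem exists_plateau {K : ℝ} (hKb : ∀ s, |deriv Real.smoothTransition s| ≤ K) {A : Set ℝ}
    (hA : MeasurableSet A) (hfin : volume A ≠ ∞) {h L : ℝ} (hh : 0 < h) (hhL : h ≤ L) :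
    ∃ τ : ℝ → ℝ, ContDiff ℝ 1 τ ∧ (∀ s, |τ s| ≤ 1) ∧ (∀ s ∉ Set.Icc 0 (2 * L), τ s = 0) ∧
      1 - K / h * volume.real (Set.Ioc 0 h \ A) - K / L * volume.real A ≤
        ∫ s in A, deriv τ s := by
  have hL : 0 < L := hh.trans_le hhL
  have hK : 0 ≤ K := (abs_nonneg _).trans (hKb 0)
  let θ := Real.smoothTransition
  have hθ : ContDiff ℝ 1 θ := Real.smoothTransition.contDiff
  have hdθ : Continuous (deriv θ) := hθ.continuous_deriv le_rfl
  have h1 : ∀ s, HasDerivAt (fun s => θ (s / h)) (deriv θ (s / h) / h) s := fun s => by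
    have := (hθ.differentiable one_ne_zero (s / h)).hasDerivAt.comp s
      ((hasDerivAt_id s).div_const h)
    exact this.congr_deriv (by simp [div_eq_mul_inv])
  have h2 : ∀ s, HasDerivAt (fun s => θ (s / L - 1)) (deriv θ (s / L - 1) / L) s := fun s => by
    have := (hθ.differentiable one_ne_zero (s / L - 1)).hasDerivAt.comp s
      (((hasDerivAt_id s).div_const L).sub_const 1)
    exact this.congr_deriv (by simp [div_eq_mul_inv])
  have hc1 : Continuous fun s => deriv θ (s / h) / h := by fun_prop
  have hc2 : Continuous fun s => deriv θ (s / L - 1) / L := by fun_prop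
  have hsupp1 : ∀ s ∉ Set.Ioc 0 h, deriv θ (s / h) / h = 0 := fun s hs => by
    have : deriv θ (s / h) = 0 := deriv_smoothTransition_eq_zero fun hs' =>
      hs ⟨by simpa [hh] using hs'.1, by simpa [div_le_one hh] using hs'.2⟩
    rw [this, zero_div]
  have hb1 : ∀ s, ‖deriv θ (s / h) / h‖ ≤ K / h := fun s => by
    rw [norm_div, Real.norm_of_nonneg hh.le]
    gcongr
    exact hKb _
  have hb2 : ∀ s, ‖deriv θ (s / L - 1) / L‖ ≤ K / L := fun s => by
    rw [norm_div, Real.norm_of_nonneg hL.le]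
    gcongr
    exact hKb _
  have hfinite : IsFiniteMeasure (volume.restrict A) := ⟨by simpa using hfin.lt_top⟩
  have hi1 : IntegrableOn (fun s => deriv θ (s / h) / h) A :=
    Integrable.of_bound hc1.aestronglyMeasurable (K / h) (.of_forall hb1)
  have hi2 : IntegrableOn (fun s => deriv θ (s / L - 1) / L) A :=
    Integrable.of_bound hc2.aestronglyMeasurable (K / L) (.of_forall hb2)
  have htot : ∫ s in Set.Ioc 0 h, deriv θ (s / h) / h = 1 := by
    rw [← intervalIntegral.integral_of_le hh.le,
      intervalIntegral.integral_eq_sub_of_hasDerivAt (fun s _ => h1 s)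
        (hc1.intervalIntegrable _ _), div_self hh.ne', zero_div]
    simp [θ]
  have hsplit := integral_inter_add_sdiff (μ := volume) (s := Set.Ioc 0 h) hA
    (hc1.integrableOn_Ioc (a := 0) (b := h))
  have hA1 : ∫ s in A, deriv θ (s / h) / h = ∫ s in Set.Ioc 0 h ∩ A, deriv θ (s / h) / h :=
    setIntegral_eq_of_subset_of_forall_sdiff_eq_zero hA Set.inter_subset_right fun s hs =>
      hsupp1 s fun hs' => hs.2 ⟨hs', hs.1⟩
  have hdiff : ‖∫ s in Set.Ioc 0 h \ A, deriv θ (s / h) / h‖ ≤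
      K / h * volume.real (Set.Ioc 0 h \ A) :=
    norm_setIntegral_le_of_norm_le_const
      ((measure_mono Set.sdiff_subset).trans_lt measure_Ioc_lt_top) fun s _ => hb1 s
  have hlast : ‖∫ s in A, deriv θ (s / L - 1) / L‖ ≤ K / L * volume.real A :=
    norm_setIntegral_le_of_norm_le_const hfin.lt_top fun s _ => hb2 s
  have hder : ∀ s, deriv (fun s => θ (s / h) - θ (s / L - 1)) s =
      deriv θ (s / h) / h - deriv θ (s / L - 1) / L := fun s => ((h1 s).sub (h2 s)).deriv
  -- A steep rise on `[0, h]`, where `A` is nearly full, and a slow descent on `[L, 2 * L]`, where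
  -- the derivative is at most `K / L` in absolute value. Each error term comes from one of these
  -- pieces.
  refine ⟨fun s => θ (s / h) - θ (s / L - 1), ?_, fun s => ?_, fun s hs => ?_, ?_⟩
  · exact (hθ.comp (by fun_prop)).sub (hθ.comp (by fun_prop))
  · have := Real.smoothTransition.nonneg (s / h)
    have := Real.smoothTransition.nonneg (s / L - 1)
    have := Real.smoothTransition.le_one (s / h)
    have := Real.smoothTransition.le_one (s / L - 1)
    rw [abs_le]
    constructor <;> simp only [θ] <;> linarith
  · rcases lt_or_ge s 0 with h0 | h0
    · simp only [θ]
      rw [Real.smoothTransition.zero_of_nonpos (div_nonpos_of_nonpos_of_nonneg h0.le hh.le),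
        Real.smoothTransition.zero_of_nonpos, sub_zero]
      linarith [div_nonpos_of_nonpos_of_nonneg h0.le hL.le]
    · have h2L : 2 * L < s := by
        by_contra hcon
        exact hs ⟨h0, not_lt.1 hcon⟩
      have h3 : 2 ≤ s / L := (le_div_iff₀ hL).2 h2L.le
      have h4 : 1 ≤ s / h := (le_div_iff₀ hh).2 (by linarith)
      simp only [θ]
      rw [Real.smoothTransition.one_of_one_le h4,
        Real.smoothTransition.one_of_one_le (by linarith), sub_self]
  · simp only [hder]
    rw [integral_sub hi1 hi2, hA1]
    have := (abs_le.1 hdiff).2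
    have := (abs_le.1 hlast).2
    linarith

/-- In dimension one, a set of positive finite volume outside a convex body has relative
perimeter at least one. -/
theorem one_le_perimeterIn {C E : Set (EuclideanSpace ℝ (Fin 1))} (hC : IsConvexBody C)
    (hE : MeasurableSet E) (hEC : E ⊆ Cᶜ) (h0 : volume E ≠ 0) (hfin : volume E ≠ ∞) :
    1 ≤ perimeterIn E Cᶜ := by
  refine ENNReal.le_of_forall_pos_le_add fun ε hε _ => ?_
  have hε' : (0 : ℝ) < ε := NNReal.coe_pos.2 hε
  obtain ⟨K, hK, hKb⟩ := exists_bound_deriv_smoothTransition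
  have hne : (ae (volume.restrict E)).NeBot := ae_neBot.2 (by simpa using h0)
  -- A density point of `E`. The separating normal `u` points away from `C`, so the half-line from
  -- `x₀` along `u` avoids `C` and can carry a test field.
  obtain ⟨x₀, hx₀E, hdens⟩ := ((ae_restrict_mem hE).and
    (Besicovitch.ae_tendsto_measure_inter_div volume E)).exists
  obtain ⟨u, hu, δ, hδ, hsep⟩ := exists_norm_eq_one_separating hC.2.1 hC.1
    (hC.2.2.1.mono interior_subset) (hEC hx₀E)
  obtain ⟨Φ, hΦ, hmp⟩ := exists_isometryEquiv_line x₀ hu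
  have hme : MeasurableEmbedding Φ := Φ.toHomeomorph.measurableEmbedding
  set A := Φ ⁻¹' E with hA
  have hAm : MeasurableSet A := hme.measurable hE
  have hAv : volume A = volume E := hmp.measure_preimage_emb hme E
  have hΦ0 : Φ 0 = x₀ := by simp [hΦ]
  have hball : ∀ h, Φ ⁻¹' Metric.closedBall x₀ h = Metric.closedBall 0 h := fun h => by
    rw [← hΦ0, Φ.isometry.preimage_closedBall]
  -- At most `2 * h * κ` of `(0, h]` is missed by `A`, so the rise loses at most `2 * K * κ = ε /
  -- 2`; `L` below makes the loss in the descent at most `ε / 2` as well.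
  set κ : ℝ := ε / (4 * K) with hκ
  have hκpos : 0 < κ := by positivity
  have hlt : ENNReal.ofReal (1 - κ) < 1 := by
    rw [← ENNReal.ofReal_one]
    exact (ENNReal.ofReal_lt_ofReal_iff one_pos).2 (by linarith)
  obtain ⟨h, hhd, hh⟩ := ((hdens.eventually (lt_mem_nhds hlt)).and self_mem_nhdsWithin).exists
  replace hh : 0 < h := hh
  have hden : 2 * h * (1 - κ) ≤ volume.real (A ∩ Metric.closedBall 0 h) := by
    have e1 : volume (E ∩ Metric.closedBall x₀ h) = volume (A ∩ Metric.closedBall 0 h) := by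
      rw [← hmp.measure_preimage_emb hme, Set.preimage_inter, hball]
    have e2 : volume (Metric.closedBall x₀ h) = ENNReal.ofReal (2 * h) := by
      rw [← hmp.measure_preimage_emb hme, hball, Real.volume_closedBall]
    have hfin' : volume (A ∩ Metric.closedBall 0 h) ≠ ∞ :=
      ((measure_mono Set.inter_subset_left).trans_lt (hAv ▸ hfin.lt_top)).ne
    rw [e1, e2] at hhd
    have := ENNReal.mul_le_of_le_div hhd.le
    rw [mul_comm, ← ENNReal.ofReal_mul (by positivity)] at this
    exact (ENNReal.ofReal_le_iff_le_toReal hfin').1 this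
  have hcomp : volume.real (Set.Ioc 0 h \ A) ≤ 2 * h * κ := by
    have hsub : Set.Ioc 0 h \ A ⊆ Metric.closedBall 0 h \ A := by
      refine Set.sdiff_subset_sdiff_left fun s hs => ?_
      rw [Metric.mem_closedBall, Real.dist_0_eq_abs, abs_of_pos hs.1]
      exact hs.2
    have hf : volume (Metric.closedBall (0 : ℝ) h) ≠ ∞ := measure_closedBall_lt_top.ne
    have h1 := measureReal_mono (μ := volume) hsub
      ((measure_mono Set.sdiff_subset).trans_lt hf.lt_top).ne
    have h2 := measureReal_inter_add_sdiff (μ := volume) (s := Metric.closedBall (0 : ℝ) h) hAm hf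
    rw [Real.volume_real_closedBall hh.le, Set.inter_comm] at h2
    linarith
  set L : ℝ := max h (2 * K * volume.real A / ε) with hL
  have hLpos : 0 < L := hh.trans_le (le_max_left _ _)
  obtain ⟨τ, hτ, hτ1, hτ0, hint⟩ := exists_plateau hKb hAm (hAv ▸ hfin) hh
    (le_max_left h (2 * K * volume.real A / ε))
  rw [← hL] at hint hτ0
  let T : EuclideanSpace ℝ (Fin 1) → EuclideanSpace ℝ (Fin 1) :=
    fun x => τ (inner ℝ u (x - x₀)) • u
  have huu : inner ℝ u u = (1 : ℝ) := by rw [real_inner_self_eq_norm_sq, hu, one_pow]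
  have hcoord : ∀ s, inner ℝ u (x₀ + s • u - x₀) = s := fun s => by
    rw [add_sub_cancel_left, real_inner_smul_right, huu, mul_one]
  have hcompact : IsCompact (Φ '' Set.Icc 0 (2 * L)) := isCompact_Icc.image Φ.continuous
  have hsupp : tsupport T ⊆ Φ '' Set.Icc 0 (2 * L) := by
    refine closure_minimal (fun x hx => ?_) hcompact.isClosed
    obtain ⟨s, rfl⟩ := Φ.surjective x
    refine Set.mem_image_of_mem _ ?_
    by_contra hs
    refine hx ?_
    simp only [T]
    rw [hΦ, hcoord, hτ0 s hs, zero_smul]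
  have hT : IsTestField Cᶜ T := by
    refine ⟨(hτ.comp ?_).smul contDiff_const, hcompact.of_isClosed_subset (isClosed_tsupport T)
      hsupp, fun x hx hxC => ?_, fun x => ?_⟩
    · exact contDiff_const.inner ℝ (contDiff_id.sub contDiff_const)
    · obtain ⟨s, hs, rfl⟩ := hsupp hx
      have := hsep _ hxC
      rw [hΦ, hcoord] at this
      linarith [hs.1]
    · simp only [T]
      rw [norm_smul, hu, mul_one]
      exact hτ1 _
  have hTint : ∫ x in E, divergence T x = ∫ s in A, deriv τ s := by
    rw [← hmp.setIntegral_preimage_emb hme]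
    refine integral_congr_ae (.of_forall fun s => ?_)
    have hfun : (fun s : ℝ => inner ℝ u (T (x₀ + s • u))) = τ := by
      funext s
      simp only [T]
      rw [hcoord, real_inner_smul_right, huu, mul_one]
    have := (hasDerivAt_inner_line hT.contDiff hu x₀ s).deriv
    rw [hfun] at this
    simp only [hΦ]
    exact this.symm
  have hfinal : 1 - (ε : ℝ) ≤ ∫ x in E, divergence T x := by
    rw [hTint]
    refine le_trans ?_ hint
    have e1 : K / h * volume.real (Set.Ioc 0 h \ A) ≤ ε / 2 := by
      calc K / h * volume.real (Set.Ioc 0 h \ A) ≤ K / h * (2 * h * κ) := by gcongr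
        _ = ε / 2 := by
          rw [hκ]
          field_simp
          ring
    have e2 : K / L * volume.real A ≤ ε / 2 := by
      have := le_max_right h (2 * K * volume.real A / ε)
      rw [← hL, div_le_iff₀ hε'] at this
      rw [div_mul_eq_mul_div, div_le_iff₀ hLpos]
      linarith
    linarith
  calc (1 : ℝ≥0∞) = ENNReal.ofReal ((1 - ε) + ε) := by simp
    _ ≤ ENNReal.ofReal (1 - ε) + ENNReal.ofReal ε := ENNReal.ofReal_add_le
    _ ≤ perimeterIn E Cᶜ + ε := by
      rw [ENNReal.ofReal_coe_nnreal]
      gcongr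
      exact (ENNReal.ofReal_le_ofReal hfinal).trans (hT.ofReal_integral_le E)

theorem one_le_exteriorProfile {C : Set (EuclideanSpace ℝ (Fin 1))} (hC : IsConvexBody C) {v : ℝ}
    (hv : 0 < v) : 1 ≤ exteriorProfile C v :=
  le_iInf fun _ => le_iInf fun hE => le_iInf fun hEC => le_iInf fun hEv =>
    one_le_perimeterIn hC hE hEC (by simpa [hEv] using hv) (by simp [hEv])

end ExteriorIsoperimetric

theorem mainTheorem8 {N : ℕ} (Cs : ℕ → Set (EuclideanSpace ℝ (Fin N)))
    (C : Set (EuclideanSpace ℝ (Fin N)))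
    (hCs : ∀ n, ExteriorIsoperimetric.IsConvexBody (Cs n))
    (hC : ExteriorIsoperimetric.IsConvexBody C)
    (hconv : ExteriorIsoperimetric.KuratowskiTendsto Cs C)
    (v : ℝ) (hv : 0 < v) :
    Filter.limsup (fun n => ExteriorIsoperimetric.exteriorProfile (Cs n) v) Filter.atTop ≤
      ExteriorIsoperimetric.exteriorProfile C v := by
  rcases N with _ | _ | N
  -- In dimension zero the space is a point, so a nonempty set is everything.
  · exact absurd (Subsingleton.eq_univ_of_nonempty (hC.2.2.1.mono interior_subset)) hC.2.2.2
  · exact (Filter.limsup_le_of_le (by isBoundedDefault) (.of_forall fun n =>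
      ExteriorIsoperimetric.exteriorProfile_le_one (hCs n) hv)).trans
      (ExteriorIsoperimetric.one_le_exteriorProfile hC hv)
  · exact ExteriorIsoperimetric.limsup_exteriorProfile_le (by omega) hCs hC hconv hv
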